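/- Let $\mathbb{S}^2\subset\mathbb{R}^3$ be the unit sphere with its round metric and area measure $dM$, oriented by the outward unit normal, with complex structure $J$ given by $Jv=x\times v$ for $v\in T_x\mathbb{S}^2$. Let $\phi=(\phi_1,\phi_2,\phi_3):\mathbb{S}^2\to\mathbb{R}^3$ be the inclusion map and $\nabla$ the gradient on $\mathbb{S}^2$. For $l\in\mathbb{N}$ put $\lambda_l=l(l+1)$ and let $$E_{\lambda_l}=\{f\in C^\infty(\mathbb{S}^2;\mathbb{R}):\ \Delta f=-\lambda_l f\},$$ where $\Delta=\operatorname{div}\nabla$ is the Laplace–Beltrami operator of $\mathbb{S}^2$. Let $l\ge 6$ and let $f_4,f_5,f_6,f_7\in E_{\lambda_l}$. Then the long integral Cauchy–Riemann inequality holds: $$\begin{aligned} &4\int_{\mathbb{S}^2}\phi_1\big(\langle J\nabla f_4,\nabla f_5\rangle+\langle J\nabla f_6,\nabla f_7\rangle\big)\,dM +4\int_{\mathbb{S}^2}\phi_2\big(\langle J\nabla f_4,\nabla f_6\rangle-\langle J\nabla f_5,\nabla f_7\rangle\big)\,dM\\ &\quad-4\int_{\mathbb{S}^2}\phi_3\big(\langle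 J\nabla f_4,\nabla f_7\rangle+\langle J\nabla f_5,\nabla f_6\rangle\big)\,dM \ \le\ \int_{\mathbb{S}^2}\big(\|\nabla f_4\|^2+\|\nabla f_5\|^2+\|\nabla f_6\|^2+\|\nabla f_7\|^2\big)\,dM . \end{aligned}$$ -/

import Mathlib

open MeasureTheory
open scoped Manifold ContDiff

noncomputable section

namespace CauchyRiemannSphere

/-- Euclidean three-space. -/
abbrev E3 : Type := EuclideanSpace ℝ (Fin 3)

/-- The unit sphere of Euclidean three-space. -/
abbrev S2 : Type := Metric.sphere (0 : E3) 1

/-- The extension of a function on the sphere to all of `E3` that is constant along the open rays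
from the origin (the value at the origin is irrelevant). -/
def radialExt {F : Type} [Zero F] (f : S2 → F) (y : E3) : F :=
  if h : y ≠ 0 then f ⟨‖y‖⁻¹ • y, by simp [norm_smul, h]⟩ else 0

/-- The Riemannian gradient on the round sphere. Since `radialExt f` does not vary in the
normal direction, its Euclidean gradient at a point `x` of the sphere is the tangent vector at `x`
that represents the differential of `f`. -/
def sphereGrad (f : S2 → ℝ) (x : S2) : E3 :=
  gradient (radialExt f) (x : E3)

/-- The Riemannian divergence on the round sphere of a tangent vector field, written as an
`E3`-valued map: the trace of the tangential derivative. The radially constant extension has no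
derivative in the normal direction, so the full trace is the trace over the tangent plane. -/
def sphereDiv (X : S2 → E3) (x : S2) : ℝ :=
  LinearMap.trace ℝ E3 (fderiv ℝ (radialExt X) (x : E3) : E3 →L[ℝ] E3).toLinearMap

/-- The Laplace-Beltrami operator of the round sphere, `Δ f = div (∇ f)`. -/
def laplaceBeltrami (f : S2 → ℝ) (x : S2) : ℝ :=
  sphereDiv (sphereGrad f) x

/-- The complex structure of the sphere (oriented by the outward normal): rotation of the tangent
plane at `x` by a right angle, `J v = x × v`. -/
def sphereJ (x : S2) (v : E3) : E3 :=
  WithLp.toLp 2 (crossProduct (WithLp.ofLp (x : E3)) (WithLp.ofLp v))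

/-- The eigenvalues `l (l + 1)` of the sphere. -/
def eigenvalue (l : ℕ) : ℝ := (l : ℝ) * ((l : ℝ) + 1)

/-- The eigenspace of the eigenvalue `lam`: the smooth functions with `Δ f = - lam f`. -/
def eigenspace (lam : ℝ) : Set (S2 → ℝ) :=
  {f | ContMDiff (𝓡 2) 𝓘(ℝ, ℝ) ∞ f ∧ ∀ x, laplaceBeltrami f x = -lam * f x}

/-- The area measure of the unit sphere. -/
def area : Measure S2 := (volume : Measure E3).toSphere

/-- The function `⟨J ∇ f, ∇ h⟩` on the sphere. -/
def bracket (f h : S2 → ℝ) (x : S2) : ℝ :=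
  inner ℝ (sphereJ x (sphereGrad f x)) (sphereGrad h x)

/-- The coordinate functions of the inclusion of the sphere into `E3`. The indices
`0, 1, 2` stand for the coordinates numbered `1, 2, 3`. -/
def coord (i : Fin 3) (x : S2) : ℝ := (x : E3) i

/-- The long integral Cauchy-Riemann inequality for a 4-tuple of functions on the sphere. -/
def LongCauchyRiemann (f₄ f₅ f₆ f₇ : S2 → ℝ) : Prop :=
  4 * (∫ x, coord 0 x * (bracket f₄ f₅ x + bracket f₆ f₇ x) ∂area)
    + 4 * (∫ x, coord 1 x * (bracket f₄ f₆ x - bracket f₅ f₇ x) ∂area)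
    - 4 * (∫ x, coord 2 x * (bracket f₄ f₇ x + bracket f₅ f₆ x) ∂area)
  ≤ ∫ x, (‖sphereGrad f₄ x‖ ^ 2 + ‖sphereGrad f₅ x‖ ^ 2
      + ‖sphereGrad f₆ x‖ ^ 2 + ‖sphereGrad f₇ x‖ ^ 2) ∂area

end CauchyRiemannSphere

end

noncomputable section

namespace CauchyRiemannSphere

/-! Write L_i for the infinitesimal rotation about the i-th axis (`rot i`). On the sphere |∇f|² = Σ
(L_i f)² and Δ = Σ L_i², while φ_i⟨J∇f,∇h⟩ is the i-th component of Lf × Lh. Rotations preserve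
area, so every L_i u has integral zero (`integral_rot`). Integrating by parts and using [L_{i+1},
L_{i+2}] = -L_i gives ∫ φ_i⟨J∇f,∇h⟩ = -∫ h L_i f (`integral_coord_mul_bracket`).

Each of the six terms on the left is therefore a product of one function and one rotational
derivative. A weighted Young inequality splits it; the L² norms are absorbed by ∫|∇f|² = λ∫f² with λ
≥ 42, and the three components L_i f add up to |∇f|². -/

lemma fin_three_add : (2 : Fin 3) + 1 = 0 ∧ (2 : Fin 3) + 2 = 1 ∧ (1 : Fin 3) + 1 = 2 ∧
    (1 : Fin 3) + 2 = 0 := by decide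

/-! ### Calculus of infinitesimal rotations off the origin; axis indices are cyclic mod 3. -/

/-- Smoothness on the complement of the origin. -/
def SmoothOffZero (u : E3 → ℝ) : Prop := ∀ y, y ≠ 0 → ContDiffAt ℝ ∞ u y

/-- The partial derivative in the `j`-th coordinate direction. -/
def pd (j : Fin 3) (u : E3 → ℝ) (y : E3) : ℝ := fderiv ℝ u y (EuclideanSpace.single j 1)

/-- The derivative along the infinitesimal rotation about the `i`-th coordinate axis. -/
def rot (i : Fin 3) (u : E3 → ℝ) (y : E3) : ℝ :=
  y (i + 1) * pd (i + 2) u y - y (i + 2) * pd (i + 1) u y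

lemma SmoothOffZero.differentiableAt {u : E3 → ℝ} (hu : SmoothOffZero u) {y : E3} (hy : y ≠ 0) :
    DifferentiableAt ℝ u y := (hu y hy).differentiableAt (by simp)

lemma SmoothOffZero.mul {u v : E3 → ℝ} (hu : SmoothOffZero u) (hv : SmoothOffZero v) :
    SmoothOffZero (fun y => u y * v y) := fun y hy => (hu y hy).mul (hv y hy)

lemma SmoothOffZero.sub {u v : E3 → ℝ} (hu : SmoothOffZero u) (hv : SmoothOffZero v) :
    SmoothOffZero (fun y => u y - v y) := fun y hy => (hu y hy).sub (hv y hy)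

lemma smoothOffZero_coord (i : Fin 3) : SmoothOffZero (fun y => y i) := fun y _ => by
  have : ContDiff ℝ ∞ (fun y : E3 => y i) := by fun_prop
  exact this.contDiffAt

lemma SmoothOffZero.pd {u : E3 → ℝ} (hu : SmoothOffZero u) (j : Fin 3) :
    SmoothOffZero (pd j u) := fun y hy =>
  ((hu y hy).fderiv_right (m := ∞) (by simp)).clm_apply contDiffAt_const

lemma SmoothOffZero.rot {u : E3 → ℝ} (hu : SmoothOffZero u) (i : Fin 3) :
    SmoothOffZero (rot i u) :=
  ((smoothOffZero_coord _).mul (hu.pd _)).sub ((smoothOffZero_coord _).mul (hu.pd _))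

lemma pd_mul {u v : E3 → ℝ} (hu : SmoothOffZero u) (hv : SmoothOffZero v) (j : Fin 3) {y : E3}
    (hy : y ≠ 0) : pd j (fun y => u y * v y) y = u y * pd j v y + v y * pd j u y := by
  unfold pd
  rw [fderiv_fun_mul (hu.differentiableAt hy) (hv.differentiableAt hy)]
  simp

lemma pd_sub {u v : E3 → ℝ} (hu : SmoothOffZero u) (hv : SmoothOffZero v) (j : Fin 3) {y : E3}
    (hy : y ≠ 0) : pd j (fun y => u y - v y) y = pd j u y - pd j v y := by
  unfold pd
  rw [fderiv_fun_sub (hu.differentiableAt hy) (hv.differentiableAt hy)]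
  simp

lemma pd_coord (i j : Fin 3) (y : E3) : pd j (fun y => y i) y = if i = j then 1 else 0 := by
  have : HasFDerivAt (fun y : E3 => y i) (EuclideanSpace.proj i : E3 →L[ℝ] ℝ) y :=
    (EuclideanSpace.proj i : E3 →L[ℝ] ℝ).hasFDerivAt
  unfold pd
  rw [this.fderiv]
  simp

lemma pd_comm {u : E3 → ℝ} (hu : SmoothOffZero u) (i j : Fin 3) {y : E3} (hy : y ≠ 0) :
    pd i (pd j u) y = pd j (pd i u) y := by
  have hd : DifferentiableAt ℝ (fderiv ℝ u) y :=
    ((hu y hy).fderiv_right (m := ∞) (by simp)).differentiableAt (by simp)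
  have key (a b : Fin 3) : pd a (pd b u) y =
      fderiv ℝ (fderiv ℝ u) y (EuclideanSpace.single a 1) (EuclideanSpace.single b 1) := by
    have : HasFDerivAt (pd b u)
        ((fderiv ℝ (fderiv ℝ u) y).flip (EuclideanSpace.single b 1)) y := by
      have h := hd.hasFDerivAt.clm_apply
        (hasFDerivAt_const (EuclideanSpace.single b (1 : ℝ) : E3) y)
      rwa [ContinuousLinearMap.comp_zero, zero_add] at h
    rw [pd, this.fderiv]
    simp
  rw [key, key]
  exact (hu y hy).isSymmSndFDerivAt (by
    rw [minSmoothness_of_isRCLikeNormedField]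
    exact WithTop.coe_le_coe.2 (le_top : (2 : ℕ∞) ≤ ⊤)) _ _

lemma fderiv_eq_sum_pd (u : E3 → ℝ) (y v : E3) : fderiv ℝ u y v = ∑ j, v j * pd j u y := by
  have hv : v = ∑ j, v j • EuclideanSpace.single j (1 : ℝ) := by
    ext i; simp [Pi.single_apply]
  conv_lhs => rw [hv]
  simp [pd]

lemma rot_mul {u v : E3 → ℝ} (hu : SmoothOffZero u) (hv : SmoothOffZero v) (i : Fin 3) {y : E3}
    (hy : y ≠ 0) : rot i (fun y => u y * v y) y = u y * rot i v y + v y * rot i u y := by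
  unfold rot
  rw [pd_mul hu hv _ hy, pd_mul hu hv _ hy]
  ring

lemma pd_rot {u : E3 → ℝ} (hu : SmoothOffZero u) (i j : Fin 3) {y : E3} (hy : y ≠ 0) :
    pd j (rot i u) y = y (i + 1) * pd j (pd (i + 2) u) y - y (i + 2) * pd j (pd (i + 1) u) y
      + (if i + 1 = j then pd (i + 2) u y else 0) - (if i + 2 = j then pd (i + 1) u y else 0) := by
  have : rot i u = fun y => y (i + 1) * pd (i + 2) u y - y (i + 2) * pd (i + 1) u y := rfl
  rw [this, pd_sub ((smoothOffZero_coord _).mul (hu.pd _)) ((smoothOffZero_coord _).mul (hu.pd _))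
    _ hy, pd_mul (smoothOffZero_coord _) (hu.pd _) _ hy,
    pd_mul (smoothOffZero_coord _) (hu.pd _) _ hy, pd_coord, pd_coord]
  split_ifs <;> ring

/-- The commutation relations of the infinitesimal rotations. -/
lemma rot_commutator {u : E3 → ℝ} (hu : SmoothOffZero u) (i : Fin 3) {y : E3} (hy : y ≠ 0) :
    rot (i + 1) (rot (i + 2) u) y - rot (i + 2) (rot (i + 1) u) y = - rot i u y := by
  have h01 := pd_comm hu 0 1 hy
  have h02 := pd_comm hu 0 2 hy
  have h12 := pd_comm hu 1 2 hy
  have e (j : Fin 3) (w : E3 → ℝ) :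
      rot j w y = y (j + 1) * pd (j + 2) w y - y (j + 2) * pd (j + 1) w y := rfl
  rw [e (i + 1), e (i + 2), e i]
  simp only [pd_rot hu _ _ hy]
  fin_cases i <;> simp [h01, h02, h12, fin_three_add] <;> ring

/-! ### Identities for functions homogeneous of degree zero -/

/-- Euler's relation for functions that are homogeneous of degree zero. -/
def Euler (u : E3 → ℝ) : Prop := ∀ y, y ≠ 0 → ∑ j, y j * pd j u y = 0

lemma Euler.second {u : E3 → ℝ} (hu : SmoothOffZero u) (he : Euler u) (m : Fin 3) {y : E3}
    (hy : y ≠ 0) : pd m u y + ∑ j, y j * pd m (pd j u) y = 0 := by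
  have h0 : (fun z : E3 => ∑ j, z j * pd j u z) =ᶠ[nhds y] fun _ => 0 := by
    filter_upwards [isOpen_ne.mem_nhds hy] with z hz using he z hz
  have h1 : pd m (fun z : E3 => ∑ j, z j * pd j u z) y = 0 := by
    rw [pd, h0.fderiv_eq]; simp
  have h2 : pd m (fun z : E3 => ∑ j, z j * pd j u z) y
      = ∑ j, pd m (fun z : E3 => z j * pd j u z) y := by
    change fderiv ℝ (fun z : E3 => ∑ j, z j * pd j u z) y _ = _
    rw [fderiv_fun_sum (A := fun j z => z j * pd j u z) fun j _ => ((smoothOffZero_coord j).mul (hu.pd j)).differentiableAt hy]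
    simp [pd]
  rw [h2] at h1
  simp only [pd_mul (smoothOffZero_coord _) (hu.pd _) _ hy, pd_coord] at h1
  rw [← h1, Finset.sum_add_distrib]
  simp [add_comm]

/-- Lagrange's identity |y × ∇u|² = |y|²|∇u|² - (y·∇u)², whose last term vanishes by Euler's
relation. -/
lemma sum_rot_sq {u : E3 → ℝ} (he : Euler u) {y : E3} (hy : y ≠ 0) :
    ∑ i, rot i u y ^ 2 = (∑ i, y i ^ 2) * ∑ i, pd i u y ^ 2 := by
  have h := he y hy
  simp only [rot, Fin.sum_univ_three] at *
  simp only [fin_three_add, zero_add] at *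
  linear_combination (- (y 0 * pd 0 u y + y 1 * pd 1 u y + y 2 * pd 2 u y)) * h

/-- The difference of the two sides is a combination of Euler's relation and its first derivatives.
-/
lemma sum_rot_rot {u : E3 → ℝ} (hu : SmoothOffZero u) (he : Euler u) {y : E3} (hy : y ≠ 0) :
    ∑ i, rot i (rot i u) y = (∑ i, y i ^ 2) * ∑ i, pd i (pd i u) y := by
  have h := he y hy
  have h0 := he.second hu 0 hy
  have h1 := he.second hu 1 hy
  have h2 := he.second hu 2 hy
  have h01 := pd_comm hu 0 1 hy
  have h02 := pd_comm hu 0 2 hy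
  have h12 := pd_comm hu 1 2 hy
  have e (j : Fin 3) (w : E3 → ℝ) :
      rot j w y = y (j + 1) * pd (j + 2) w y - y (j + 2) * pd (j + 1) w y := rfl
  simp only [Fin.sum_univ_three, e _ (rot _ u), pd_rot hu _ _ hy] at *
  simp only [fin_three_add, zero_add, Fin.reduceEq, if_true, if_false] at *
  simp only [h01, h02, h12] at *
  linear_combination (- y 0) * h0 + (- y 1) * h1 + (- y 2) * h2 - h

/-! ### From the sphere to radial extensions -/

lemma sphere_ne_zero (x : S2) : (x : E3) ≠ 0 := ne_zero_of_mem_unit_sphere x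

lemma sum_sq_sphere (x : S2) : ∑ i, (x : E3) i ^ 2 = 1 := by
  have h : ‖(x : E3)‖ = 1 := by simp
  rw [← EuclideanSpace.real_norm_sq_eq, h, one_pow]

lemma radialExt_sphere (f : S2 → ℝ) (x : S2) : radialExt f (x : E3) = f x := by
  have h : ‖(x : E3)‖ = 1 := by simp
  rw [radialExt, dif_pos (sphere_ne_zero x)]
  congr 1
  ext1
  simp [h]

lemma radialExt_smul (f : S2 → ℝ) {c : ℝ} (hc : 0 < c) (y : E3) :
    radialExt f (c • y) = radialExt f y := by
  by_cases hy : y = 0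
  · simp [hy]
  · rw [radialExt, radialExt, dif_pos hy, dif_pos (smul_ne_zero hc.ne' hy)]
    congr 2
    rw [norm_smul, smul_smul, Real.norm_of_nonneg hc.le]
    congr 1
    field_simp

lemma smoothOffZero_radialExt {f : S2 → ℝ} (hf : ContMDiff (𝓡 2) 𝓘(ℝ, ℝ) ∞ f) :
    SmoothOffZero (radialExt f) := by
  intro y hy
  let U : TopologicalSpace.Opens E3 := ⟨{0}ᶜ, isOpen_compl_singleton⟩
  have hU (z : U) : (z : E3) ≠ 0 := z.2
  have hn : ContMDiff 𝓘(ℝ, E3) 𝓘(ℝ, E3) ∞ (fun z : U => ‖(z : E3)‖⁻¹ • (z : E3)) := by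
    intro z
    refine (contMDiffAt_subtype_iff (U := U) (f := fun z : E3 => ‖z‖⁻¹ • z)).2 ?_
    refine ContDiffAt.contMDiffAt ?_
    exact ((contDiffAt_norm ℝ (hU z)).inv (norm_ne_zero_iff.2 (hU z))).smul contDiffAt_id
  have hs (z : U) : ‖(z : E3)‖⁻¹ • (z : E3) ∈ Metric.sphere (0 : E3) 1 := by
    simp [norm_smul, hU z]
  have : Fact (Module.finrank ℝ E3 = 2 + 1) := ⟨by simp⟩
  have hc := hf.comp (hn.codRestrict_sphere (n := 2) hs)
  have := hc ⟨y, hy⟩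
  have heq : f ∘ Set.codRestrict (fun z : U => ‖(z : E3)‖⁻¹ • (z : E3)) _ hs
      = fun z : U => radialExt f z := by
    ext z
    rw [radialExt, dif_pos (hU z)]
    rfl
  rw [heq, contMDiffAt_subtype_iff (U := U) (f := radialExt f)] at this
  exact this.contDiffAt

/-- First derivatives of a function homogeneous of degree 0 are homogeneous of degree -1. -/
lemma pd_smul_radialExt (f : S2 → ℝ) {c : ℝ} (hc : 0 < c) (j : Fin 3) (y : E3) :
    pd j (radialExt f) y = c * pd j (radialExt f) (c • y) := by
  have h : (fun y => radialExt f (c • y)) = radialExt f := by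
    ext z; exact radialExt_smul f hc z
  have := fderiv_comp_smul (𝕜 := ℝ) (f := radialExt f) (x := y) c
  rw [h] at this
  simp [pd, this]

lemma euler_radialExt {f : S2 → ℝ} (hf : SmoothOffZero (radialExt f)) : Euler (radialExt f) := by
  intro y hy
  rw [← fderiv_eq_sum_pd]
  have h1 : HasDerivAt (fun t : ℝ => t • y) y 1 := by
    simpa using (hasDerivAt_id (1 : ℝ)).smul_const y
  have h2 : HasDerivAt (fun t : ℝ => radialExt f (t • y)) (fderiv ℝ (radialExt f) y y) 1 := by
    have h := (hf.differentiableAt hy).hasFDerivAt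
    rw [← one_smul ℝ y] at h
    have h3 := HasFDerivAt.comp_hasDerivAt (1 : ℝ) h h1
    rw [one_smul] at h3
    exact h3
  have h3 : (fun t : ℝ => radialExt f (t • y)) =ᶠ[nhds 1] fun _ => radialExt f y := by
    filter_upwards [lt_mem_nhds one_pos] with t ht using radialExt_smul f ht y
  exact h2.unique ((hasDerivAt_const (1 : ℝ) _).congr_of_eventuallyEq h3)

lemma gradient_apply (u : E3 → ℝ) (y : E3) (j : Fin 3) : gradient u y j = pd j u y := by
  have h : inner ℝ (gradient u y) (EuclideanSpace.single j 1) = pd j u y := by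
    rw [gradient, InnerProductSpace.toDual_symm_apply, pd]
  rw [← h, EuclideanSpace.inner_single_right]
  simp

lemma sphereGrad_apply (f : S2 → ℝ) (x : S2) (j : Fin 3) :
    sphereGrad f x j = pd j (radialExt f) x := gradient_apply _ _ _

lemma norm_sphereGrad_sq {f : S2 → ℝ} (hf : SmoothOffZero (radialExt f)) (x : S2) :
    ‖sphereGrad f x‖ ^ 2 = ∑ i, rot i (radialExt f) x ^ 2 := by
  rw [sum_rot_sq (euler_radialExt hf) (sphere_ne_zero x), sum_sq_sphere, one_mul,
    EuclideanSpace.real_norm_sq_eq]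
  simp only [sphereGrad_apply]

/-- The vector identity (x × a) × (x × b) = det(x, a, b) x with a = ∇f, b = ∇h. -/
lemma coord_mul_bracket (f h : S2 → ℝ) (i : Fin 3) (x : S2) :
    coord i x * bracket f h x =
      rot (i + 1) (radialExt f) x * rot (i + 2) (radialExt h) x
        - rot (i + 2) (radialExt f) x * rot (i + 1) (radialExt h) x := by
  simp only [bracket, sphereJ, coord, PiLp.inner_apply, Fin.sum_univ_three, rot, crossProduct,
    sphereGrad_apply]
  fin_cases i <;> simp [sphereGrad_apply, fin_three_add] <;> ring

lemma smoothOffZero_norm : SmoothOffZero (fun y => ‖y‖) := fun _ hy => contDiffAt_norm ℝ hy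

lemma norm_mul_pd_norm (j : Fin 3) {y : E3} (hy : y ≠ 0) :
    ‖y‖ * pd j (fun y => ‖y‖) y = y j := by
  have h1 := pd_mul smoothOffZero_norm smoothOffZero_norm j hy
  have h2 : (fun y : E3 => ‖y‖ * ‖y‖) = fun y => ‖y‖ ^ 2 := by ext; ring
  have h3 : pd j (fun y : E3 => ‖y‖ ^ 2) y = 2 * y j := by
    rw [pd, fderiv_norm_sq_apply]
    simp [EuclideanSpace.inner_single_right]
  rw [h2, h3] at h1
  linarith

/-- By homogeneity, the radial extension of ∇f is ‖y‖ times the Euclidean gradient of the extension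
of f. The factor ‖y‖ adds only x·∇u to the divergence, which is zero by Euler's relation. -/
lemma laplaceBeltrami_eq_sum_pd {f : S2 → ℝ} (hf : SmoothOffZero (radialExt f)) (x : S2) :
    laplaceBeltrami f x = ∑ j, pd j (pd j (radialExt f)) x := by
  have hx : ‖(x : E3)‖ = 1 := by simp
  have hloc : radialExt (sphereGrad f) =ᶠ[nhds (x : E3)]
      fun y => WithLp.toLp 2 (fun j => ‖y‖ * pd j (radialExt f) y) := by
    filter_upwards [isOpen_ne.mem_nhds (sphere_ne_zero x)] with y hy
    ext j
    rw [radialExt, dif_pos hy, sphereGrad_apply]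
    have := pd_smul_radialExt f (inv_pos.2 (norm_pos_iff.2 hy)) j y
    simp only [this]
    field_simp [norm_ne_zero_iff.2 hy]
  have hd (j : Fin 3) : DifferentiableAt ℝ (fun y => ‖y‖ * pd j (radialExt f) y) (x : E3) :=
    (smoothOffZero_norm.mul (hf.pd j)).differentiableAt (sphere_ne_zero x)
  have hD : HasFDerivAt (fun y : E3 => (WithLp.toLp 2 (fun j => ‖y‖ * pd j (radialExt f) y) : E3))
      (((PiLp.continuousLinearEquiv 2 ℝ (fun _ : Fin 3 => ℝ)).symm : (Fin 3 → ℝ) →L[ℝ] E3).comp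
        (ContinuousLinearMap.pi fun j => fderiv ℝ (fun y => ‖y‖ * pd j (radialExt f) y) (x : E3)))
      (x : E3) :=
    ((PiLp.continuousLinearEquiv 2 ℝ (fun _ : Fin 3 => ℝ)).symm :
      (Fin 3 → ℝ) →L[ℝ] E3).hasFDerivAt.comp (x : E3)
        (hasFDerivAt_pi.2 fun j => (hd j).hasFDerivAt)
  have hsum := euler_radialExt hf x (sphere_ne_zero x)
  rw [laplaceBeltrami, sphereDiv, hloc.fderiv_eq, hD.fderiv,
    LinearMap.trace_eq_sum_inner _ (EuclideanSpace.basisFun (Fin 3) ℝ)]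
  have key (j : Fin 3) : pd j (fun y => ‖y‖ * pd j (radialExt f) y) (x : E3)
      = pd j (pd j (radialExt f)) x + (x : E3) j * pd j (radialExt f) x := by
    have h := norm_mul_pd_norm j (sphere_ne_zero x)
    rw [pd_mul smoothOffZero_norm (hf.pd j) j (sphere_ne_zero x), ← h, hx]
    ring
  have : ∑ j, pd j (fun y => ‖y‖ * pd j (radialExt f) y) (x : E3)
      = ∑ j, pd j (pd j (radialExt f)) x := by
    simp only [key, Finset.sum_add_distrib, hsum, add_zero]
  rw [← this]
  refine Finset.sum_congr rfl fun j _ => ?_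
  simp [EuclideanSpace.basisFun_apply, EuclideanSpace.inner_single_left, pd]

lemma laplaceBeltrami_eq_sum_rot {f : S2 → ℝ} (hf : SmoothOffZero (radialExt f)) (x : S2) :
    laplaceBeltrami f x = ∑ i, rot i (rot i (radialExt f)) x := by
  rw [laplaceBeltrami_eq_sum_pd hf, sum_rot_rot hf (euler_radialExt hf) (sphere_ne_zero x),
    sum_sq_sphere, one_mul]

/-! ### Rotation invariance of the area measure -/

/-- The rotation by the angle `t` about the `i`-th coordinate axis. -/
def rotation (i : Fin 3) (t : ℝ) : E3 →ₗᵢ[ℝ] E3 where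
  toFun y := WithLp.toLp 2 fun m => if m = i then y i else
    if m = i + 1 then Real.cos t * y (i + 1) - Real.sin t * y (i + 2)
    else Real.sin t * y (i + 1) + Real.cos t * y (i + 2)
  map_add' y z := by
    ext m
    simp only [PiLp.add_apply]
    split_ifs <;> ring
  map_smul' c y := by
    ext m
    simp only [PiLp.smul_apply, smul_eq_mul, RingHom.id_apply]
    split_ifs <;> ring
  norm_map' y := by
    have h := Real.sin_sq_add_cos_sq t
    rw [← sq_eq_sq₀ (norm_nonneg _) (norm_nonneg _), EuclideanSpace.real_norm_sq_eq,
      EuclideanSpace.real_norm_sq_eq]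
    fin_cases i <;> simp [Fin.sum_univ_three, fin_three_add]
    · linear_combination (y 1 ^ 2 + y 2 ^ 2) * h
    · linear_combination (y 2 ^ 2 + y 0 ^ 2) * h
    · linear_combination (y 0 ^ 2 + y 1 ^ 2) * h

lemma rotation_zero (i : Fin 3) (y : E3) : rotation i 0 y = y := by
  ext m
  fin_cases i <;> fin_cases m <;> simp [rotation, fin_three_add]

lemma hasDerivAt_rotation (i : Fin 3) (y : E3) (t : ℝ) :
    HasDerivAt (fun t => rotation i t y) (WithLp.toLp 2 fun m => if m = i then 0 else
      if m = i + 1 then - rotation i t y (i + 2) else rotation i t y (i + 1)) t := by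
  have h : HasDerivAt (fun t m => rotation i t y m) (fun m => if m = i then 0 else
      if m = i + 1 then - rotation i t y (i + 2) else rotation i t y (i + 1)) t := by
    refine hasDerivAt_pi.2 fun m => ?_
    have hc := Real.hasDerivAt_cos t
    have hs := Real.hasDerivAt_sin t
    have h12 : i + 2 ≠ i + 1 := by fin_cases i <;> decide
    have h1 : i + 1 ≠ i := by fin_cases i <;> decide
    have h2 : i + 2 ≠ i := by fin_cases i <;> decide
    have e (t : ℝ) (m : Fin 3) : rotation i t y m = if m = i then y i else
      if m = i + 1 then Real.cos t * y (i + 1) - Real.sin t * y (i + 2)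
      else Real.sin t * y (i + 1) + Real.cos t * y (i + 2) := rfl
    simp only [e, h12, h1, h2, if_true, if_false]
    split_ifs
    · exact hasDerivAt_const _ _
    · exact ((hc.mul_const _).sub (hs.mul_const _)).congr_deriv (by ring)
    · exact ((hs.mul_const _).add (hc.mul_const _)).congr_deriv (by ring)
  exact ((PiLp.continuousLinearEquiv 2 ℝ (fun _ : Fin 3 => ℝ)).symm :
      (Fin 3 → ℝ) →L[ℝ] E3).hasFDerivAt.comp_hasDerivAt t h

lemma hasDerivAt_comp_rotation {u : E3 → ℝ} (hu : SmoothOffZero u) (i : Fin 3) {y : E3}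
    (hy : y ≠ 0) (t : ℝ) :
    HasDerivAt (fun t => u (rotation i t y)) (rot i u (rotation i t y)) t := by
  have hne : rotation i t y ≠ 0 := by
    rwa [← norm_ne_zero_iff, LinearIsometry.norm_map, norm_ne_zero_iff]
  refine ((hu.differentiableAt hne).hasFDerivAt.comp_hasDerivAt t
    (hasDerivAt_rotation i y t)).congr_deriv ?_
  rw [fderiv_eq_sum_pd, Fin.sum_univ_three, rot]
  generalize rotation i t y = z
  fin_cases i <;> simp [fin_three_add] <;> ring

/-- The action of a linear isometry on the unit sphere. -/
def sphereMap (e : E3 →ₗᵢ[ℝ] E3) (x : S2) : S2 := ⟨e x, by simp⟩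

lemma continuous_sphereMap (e : E3 →ₗᵢ[ℝ] E3) : Continuous (sphereMap e) :=
  (e.continuous.comp continuous_subtype_val).subtype_mk _

open scoped Pointwise in
-- Area is defined through the volume of the cone over a set, and linear isometries preserve volume
-- and carry cones to cones.
lemma measurePreserving_sphereMap (e : E3 →ₗᵢ[ℝ] E3) :
    MeasurePreserving (sphereMap e) area area := by
  refine ⟨(continuous_sphereMap e).measurable, Measure.ext fun s hs => ?_⟩
  have hpre := (continuous_sphereMap e).measurable hs
  rw [Measure.map_apply (continuous_sphereMap e).measurable hs, area,
    Measure.toSphere_apply' _ hs, Measure.toSphere_apply' _ hpre]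
  congr 1
  let E : E3 ≃ₗᵢ[ℝ] E3 := e.toLinearIsometryEquiv rfl
  rw [← E.measurePreserving.measure_preimage_emb E.toHomeomorph.measurableEmbedding
    (Set.Ioo (0 : ℝ) 1 • (Subtype.val '' s))]
  congr 1
  have hE (y : E3) : E y = e y := rfl
  ext y
  simp only [Set.mem_smul, Set.mem_preimage, Set.mem_image]
  constructor
  · rintro ⟨r, hr, _, ⟨x, hx, rfl⟩, rfl⟩
    exact ⟨r, hr, _, ⟨_, hx, rfl⟩, by rw [hE, map_smul]; rfl⟩
  · rintro ⟨r, hr, _, ⟨x, hx, rfl⟩, h⟩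
    have hs : E.symm (x : E3) ∈ Metric.sphere (0 : E3) 1 := by simp
    refine ⟨r, hr, _, ⟨⟨E.symm x, hs⟩, ?_, rfl⟩, ?_⟩
    · have : sphereMap e ⟨E.symm x, hs⟩ = x := by
        ext1
        change E (E.symm x) = x
        simp
      rwa [this]
    · apply E.injective
      rw [map_smul, E.apply_symm_apply, h]

instance : IsFiniteMeasure area := by unfold area; infer_instance

lemma SmoothOffZero.continuous_sphere {u : E3 → ℝ} (hu : SmoothOffZero u) :
    Continuous (fun x : S2 => u x) :=
  continuous_iff_continuousAt.2 fun x =>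
    ((hu x (sphere_ne_zero x)).continuousAt).comp continuous_subtype_val.continuousAt

lemma SmoothOffZero.integrable {u : E3 → ℝ} (hu : SmoothOffZero u) :
    Integrable (fun x : S2 => u x) area :=
  hu.continuous_sphere.integrable_of_hasCompactSupport (HasCompactSupport.of_compactSpace _)

/-- The derivative along an infinitesimal rotation has integral zero over the sphere. -/
lemma integral_rot {u : E3 → ℝ} (hu : SmoothOffZero u) (i : Fin 3) :
    ∫ x : S2, rot i u x ∂area = 0 := by
  obtain ⟨C, hC⟩ := (isCompact_univ (X := S2)).exists_bound_of_continuousOn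
    (hu.rot i).continuous_sphere.continuousOn
  have hcont (t : ℝ) (w : E3 → ℝ) (hw : SmoothOffZero w) :
      Continuous fun x : S2 => w (rotation i t x) :=
    hw.continuous_sphere.comp (continuous_sphereMap (rotation i t))
  -- Differentiate t ↦ ∫ u(R_t x) under the integral sign at t = 0; by invariance this function is
  -- constant.
  have hder := (hasDerivAt_integral_of_dominated_loc_of_deriv_le (μ := area) (x₀ := (0 : ℝ))
    (F := fun t (x : S2) => u (rotation i t x)) (F' := fun t x => rot i u (rotation i t x))
    (bound := fun _ => C) Filter.univ_mem
    (Filter.Eventually.of_forall fun t => (hcont t u hu).aestronglyMeasurable)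
    (by simpa only [rotation_zero] using hu.integrable)
    (hcont 0 _ (hu.rot i)).aestronglyMeasurable
    (Filter.Eventually.of_forall fun x t _ => hC (sphereMap (rotation i t) x) (Set.mem_univ _))
    (integrable_const C)
    (Filter.Eventually.of_forall fun x t _ =>
      hasDerivAt_comp_rotation hu i (sphere_ne_zero x) t)).2
  have hconst (t : ℝ) : ∫ x : S2, u (rotation i t x) ∂area = ∫ x : S2, u x ∂area := by
    rw [← (measurePreserving_sphereMap (rotation i t)).map_eq, integral_map
      (continuous_sphereMap _).measurable.aemeasurable
      hu.continuous_sphere.aestronglyMeasurable, (measurePreserving_sphereMap _).map_eq]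
    rfl
  simp only [hconst, rotation_zero] at hder
  exact hder.unique (hasDerivAt_const _ _)

/-! ### Energy identity and bracket estimate -/

lemma integral_norm_sphereGrad_sq_eq_sum {f : S2 → ℝ} (hf : SmoothOffZero (radialExt f)) :
    ∫ x, ‖sphereGrad f x‖ ^ 2 ∂area = ∑ i, ∫ x : S2, rot i (radialExt f) x ^ 2 ∂area := by
  rw [← integral_finsetSum]
  · simp only [norm_sphereGrad_sq hf]
  · intro i _
    simpa only [sq] using ((hf.rot i).mul (hf.rot i)).integrable

lemma integrable_norm_sphereGrad_sq {f : S2 → ℝ} (hf : SmoothOffZero (radialExt f)) :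
    Integrable (fun x => ‖sphereGrad f x‖ ^ 2) area := by
  simp only [norm_sphereGrad_sq hf, sq]
  exact integrable_finsetSum _ fun i _ => ((hf.rot i).mul (hf.rot i)).integrable

/-- The Dirichlet energy of an eigenfunction. -/
lemma integral_norm_sphereGrad_sq {f : S2 → ℝ} {lam : ℝ} (hf : f ∈ eigenspace lam) :
    ∫ x, ‖sphereGrad f x‖ ^ 2 ∂area = lam * ∫ x, f x ^ 2 ∂area := by
  have hu := smoothOffZero_radialExt hf.1
  -- Σ L_i(f L_i f) = |∇f|² + fΔf.
  have hpt (x : S2) : ‖sphereGrad f x‖ ^ 2 - lam * f x ^ 2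
      = ∑ i, rot i (fun y => radialExt f y * rot i (radialExt f) y) x := by
    simp only [fun i => rot_mul hu (hu.rot i) i (sphere_ne_zero x), Finset.sum_add_distrib,
      ← Finset.mul_sum]
    rw [← laplaceBeltrami_eq_sum_rot hu, hf.2 x, radialExt_sphere, norm_sphereGrad_sq hu]
    simp only [sq]
    ring
  have hsq : Integrable (fun x => f x ^ 2) area := by
    simpa only [radialExt_sphere, sq] using (hu.mul hu).integrable
  rw [← integral_const_mul, ← sub_eq_zero,
    ← integral_sub (integrable_norm_sphereGrad_sq hu) (hsq.const_mul lam)]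
  simp only [hpt]
  rw [integral_finsetSum _ fun i _ => ((hu.mul (hu.rot i)).rot i).integrable]
  exact Finset.sum_eq_zero fun i _ => integral_rot (hu.mul (hu.rot i)) i

lemma integrable_coord_mul_bracket {f h : S2 → ℝ} (hf : SmoothOffZero (radialExt f))
    (hh : SmoothOffZero (radialExt h)) (i : Fin 3) :
    Integrable (fun x => coord i x * bracket f h x) area := by
  simp only [coord_mul_bracket]
  exact (((hf.rot _).mul (hh.rot _)).sub ((hf.rot _).mul (hh.rot _))).integrable

/-- Integration by parts for the Poisson bracket weighted by a coordinate function. -/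
lemma integral_coord_mul_bracket {f h : S2 → ℝ} (hf : SmoothOffZero (radialExt f))
    (hh : SmoothOffZero (radialExt h)) (i : Fin 3) :
    ∫ x, coord i x * bracket f h x ∂area = - ∫ x : S2, h x * rot i (radialExt f) x ∂area := by
  -- First-order products on the right form the bracket term; second-order ones form h[L_{i+2},
  -- L_{i+1}]f = h L_i f.
  have hpt (x : S2) : coord i x * bracket f h x + h x * rot i (radialExt f) x
      = rot (i + 2) (fun y => radialExt h y * rot (i + 1) (radialExt f) y) x
        - rot (i + 1) (fun y => radialExt h y * rot (i + 2) (radialExt f) y) x := by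
    have hx := sphere_ne_zero x
    have hc := rot_commutator hf i hx
    rw [coord_mul_bracket, rot_mul hh (hf.rot _) _ hx, rot_mul hh (hf.rot _) _ hx,
      radialExt_sphere]
    linear_combination (h x) * hc
  have hint : Integrable (fun x : S2 => h x * rot i (radialExt f) x) area := by
    simpa only [radialExt_sphere] using (hh.mul (hf.rot i)).integrable
  rw [← add_eq_zero_iff_eq_neg, ← integral_add (integrable_coord_mul_bracket hf hh i) hint]
  simp only [hpt]
  rw [integral_sub ((hh.mul (hf.rot _)).rot _).integrable ((hh.mul (hf.rot _)).rot _).integrable,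
    integral_rot (hh.mul (hf.rot _)), integral_rot (hh.mul (hf.rot _)), sub_zero]

/-- Young's inequality from 6(h ± L_i f/3)² ≥ 0. The weights are chosen so that the final sum closes
for λ ≥ 42. -/
lemma abs_integral_coord_mul_bracket_le {f h : S2 → ℝ} (hf : SmoothOffZero (radialExt f))
    (hh : SmoothOffZero (radialExt h)) (i : Fin 3) :
    |4 * ∫ x, coord i x * bracket f h x ∂area|
      ≤ 6 * ∫ x, h x ^ 2 ∂area + 2 / 3 * ∫ x : S2, rot i (radialExt f) x ^ 2 ∂area := by
  have h1 : Integrable (fun x => h x ^ 2) area := by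
    simpa only [radialExt_sphere, sq] using (hh.mul hh).integrable
  have h2 : Integrable (fun x : S2 => rot i (radialExt f) x ^ 2) area := by
    simpa only [sq] using ((hf.rot i).mul (hf.rot i)).integrable
  have h3 : Integrable (fun x : S2 => h x * rot i (radialExt f) x) area := by
    simpa only [radialExt_sphere] using (hh.mul (hf.rot i)).integrable
  rw [integral_coord_mul_bracket hf hh, mul_neg, abs_neg, abs_le, ← integral_const_mul,
    ← integral_const_mul, ← integral_const_mul, ← integral_add (h1.const_mul _) (h2.const_mul _),
    ← integral_neg]
  constructor
  · refine integral_mono ((h1.const_mul _).add (h2.const_mul _)).neg (h3.const_mul _) fun x => ?_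
    dsimp only
    linarith [sq_nonneg (h x + rot i (radialExt f) x / 3)]
  · refine integral_mono (h3.const_mul _) ((h1.const_mul _).add (h2.const_mul _)) fun x => ?_
    dsimp only
    linarith [sq_nonneg (h x - rot i (radialExt f) x / 3)]

end CauchyRiemannSphere

end
open CauchyRiemannSphere in
theorem proposition3p3 (l : ℕ) (hl : 6 ≤ l) (f₄ f₅ f₆ f₇ : S2 → ℝ)
    (h₄ : f₄ ∈ eigenspace (eigenvalue l)) (h₅ : f₅ ∈ eigenspace (eigenvalue l))
    (h₆ : f₆ ∈ eigenspace (eigenvalue l)) (h₇ : f₇ ∈ eigenspace (eigenvalue l)) :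
    LongCauchyRiemann f₄ f₅ f₆ f₇ := by
  have hlam : 42 ≤ eigenvalue l := by
    have : (6 : ℝ) ≤ l := by exact_mod_cast hl
    unfold eigenvalue
    nlinarith
  have energy (f : S2 → ℝ) (hf : f ∈ eigenspace (eigenvalue l)) :
      42 * ∫ x, f x ^ 2 ∂area ≤ ∫ x, ‖sphereGrad f x‖ ^ 2 ∂area := by
    rw [integral_norm_sphereGrad_sq hf]
    exact mul_le_mul_of_nonneg_right hlam (integral_nonneg fun x => sq_nonneg _)
  have hR (f : S2 → ℝ) (i : Fin 3) : 0 ≤ ∫ x : S2, rot i (radialExt f) x ^ 2 ∂area :=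
    integral_nonneg fun x => sq_nonneg _
  have hG (f : S2 → ℝ) : 0 ≤ ∫ x, ‖sphereGrad f x‖ ^ 2 ∂area :=
    integral_nonneg fun x => sq_nonneg _
  have e₄ := energy f₄ h₄
  have e₅ := energy f₅ h₅
  have e₆ := energy f₆ h₆
  have e₇ := energy f₇ h₇
  have s₄ := smoothOffZero_radialExt h₄.1
  have s₅ := smoothOffZero_radialExt h₅.1
  have s₆ := smoothOffZero_radialExt h₆.1
  have s₇ := smoothOffZero_radialExt h₇.1
  have t₄ := integral_norm_sphereGrad_sq_eq_sum s₄
  have t₅ := integral_norm_sphereGrad_sq_eq_sum s₅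
  have t₆ := integral_norm_sphereGrad_sq_eq_sum s₆
  rw [Fin.sum_univ_three] at t₄ t₅ t₆
  have b₄₅ := abs_le.1 (abs_integral_coord_mul_bracket_le s₄ s₅ 0)
  have b₆₇ := abs_le.1 (abs_integral_coord_mul_bracket_le s₆ s₇ 0)
  have b₄₆ := abs_le.1 (abs_integral_coord_mul_bracket_le s₄ s₆ 1)
  have b₅₇ := abs_le.1 (abs_integral_coord_mul_bracket_le s₅ s₇ 1)
  have b₄₇ := abs_le.1 (abs_integral_coord_mul_bracket_le s₄ s₇ 2)
  have b₅₆ := abs_le.1 (abs_integral_coord_mul_bracket_le s₅ s₆ 2)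
  have g₄ := integrable_norm_sphereGrad_sq s₄
  have g₅ := integrable_norm_sphereGrad_sq s₅
  have g₆ := integrable_norm_sphereGrad_sq s₆
  have g₇ := integrable_norm_sphereGrad_sq s₇
  have g₄₅ : Integrable (fun x => ‖sphereGrad f₄ x‖ ^ 2 + ‖sphereGrad f₅ x‖ ^ 2) area := g₄.add g₅
  have g₄₅₆ : Integrable (fun x => ‖sphereGrad f₄ x‖ ^ 2 + ‖sphereGrad f₅ x‖ ^ 2
      + ‖sphereGrad f₆ x‖ ^ 2) area := g₄₅.add g₆
  unfold LongCauchyRiemann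
  simp only [mul_add, mul_sub]
  rw [integral_add (integrable_coord_mul_bracket s₄ s₅ 0) (integrable_coord_mul_bracket s₆ s₇ 0),
    integral_sub (integrable_coord_mul_bracket s₄ s₆ 1) (integrable_coord_mul_bracket s₅ s₇ 1),
    integral_add (integrable_coord_mul_bracket s₄ s₇ 2) (integrable_coord_mul_bracket s₅ s₆ 2),
    integral_add g₄₅₆ g₇, integral_add g₄₅ g₆, integral_add g₄ g₅]
  -- With G_k = ∫|∇f_k|², the L² terms of f₅, f₆, f₇ occur 1, 2, 3 times, each costing at most 6/42
  -- = 1/7 of G_k. The rotational terms cost at most 2/3 of G₄, G₅, G₆, after restoring the missing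
  -- nonnegative components. The coefficients 2/3, 17/21, 20/21, 3/7 are all below 1.
  linarith [b₄₅.2, b₆₇.2, b₄₆.2, b₅₇.1, b₄₇.1, b₅₆.1, hR f₅ 0, hR f₆ 1, hR f₆ 2,
    hG f₄, hG f₅, hG f₆, hG f₇]
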